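/- Let $G$ be a finite simple undirected graph with $n$ vertices. Call $G$ \emph{mock threshold} if its vertices can be ordered $v_1,\dots,v_n$ so that, for every $i$ with $1\le i\le n$, the degree of $v_i$ in the induced subgraph $G[v_1,\dots,v_i]$ is $0$, $1$, $i-2$ or $i-1$. A \emph{total coloring} of $G$ is a map $f\colon V(G)\cup E(G)\to C$ to a set $C$ of colors such that $f(u)\ne f(v)$ for any two adjacent vertices $u,v$, $f(e)\ne f(e')$ for any two distinct edges $e,e'$ with a common end, and $f(v)\ne f(e)$ for any vertex $v$ and any edge $e$ incident to $v$. The \emph{total chromatic number} $\chi''(G)$ is the minimum number of colors that suffice in a total coloring of $G$, and $\Delta(G)$ is the maximum degree of $G$. Theorem. The total coloring conjecture holds for every mock threshold graph: if $G$ is mock threshold, then $$\chi''(G)\le \Delta(G)+2 .$$ -/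

import Mathlib

namespace SimpleGraph

/-- A total coloring of `G` with colors in `C`: a map on the disjoint union of the vertices and the
edges of `G` giving distinct colors to adjacent vertices, to adjacent edges (distinct edges with
a common end), and to a vertex and an edge incident to it. -/
structure TotalColoring {V : Type*} (G : SimpleGraph V) (C : Type*) where
  toFun : V ⊕ G.edgeSet → C
  vertex_vertex : ∀ u v : V, G.Adj u v → toFun (Sum.inl u) ≠ toFun (Sum.inl v)
  edge_edge : ∀ e e' : G.edgeSet, e ≠ e' → (∃ v : V, v ∈ (e : Sym2 V) ∧ v ∈ (e' : Sym2 V)) →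
    toFun (Sum.inr e) ≠ toFun (Sum.inr e')
  vertex_edge : ∀ (v : V) (e : G.edgeSet), v ∈ (e : Sym2 V) →
    toFun (Sum.inl v) ≠ toFun (Sum.inr e)

/-- The total chromatic number: the least number of colors of a total coloring of `G`
(`⊤` if no finite number of colors suffices). -/
noncomputable def totalChromaticNumber {V : Type*} (G : SimpleGraph V) : ℕ∞ :=
  ⨅ n ∈ {n : ℕ | Nonempty (G.TotalColoring (Fin n))}, (n : ℕ∞)

open Classical in
/-- The degree of the `i`-th vertex of the ordering `σ` in the subgraph of `G` induced by the
vertices up to and including that one. -/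
noncomputable def initialDegree {V : Type*} (G : SimpleGraph V) {n : ℕ} (σ : Fin n ≃ V)
    (i : Fin n) : ℕ :=
  letI : Fintype V := Fintype.ofEquiv (Fin n) σ
  (G.induce (σ '' Set.Iic i)).degree ⟨σ i, Set.mem_image_of_mem σ (Set.mem_Iic.mpr le_rfl)⟩

/-- `G` is mock threshold if its vertices have an ordering `v_1, …, v_n` such that the degree of
each `v_i` in `G[v_1, …, v_i]` is `0`, `1`, `i - 2` or `i - 1`. Positions in `Fin n` start at `0`,
so `v_i` is at position `i - 1`; the last two degrees are written without subtraction. -/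
def IsMockThreshold {V : Type*} [Fintype V] (G : SimpleGraph V) : Prop :=
  ∃ σ : Fin (Fintype.card V) ≃ V, ∀ i : Fin (Fintype.card V),
    G.initialDegree σ i = 0 ∨ G.initialDegree σ i = 1 ∨
      G.initialDegree σ i + 1 = (i : ℕ) ∨ G.initialDegree σ i = (i : ℕ)

end SimpleGraph

namespace SimpleGraph

/-! Add the vertices one by one in the mock threshold order, always keeping `Δ + 2` colors, where
`Δ` is the maximum degree of the whole graph. A new vertex without earlier neighbors costs nothing.
A new vertex with one neighbor is handled greedily (`TotalColorable.extend_pendant`). A new vertex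
adjacent to all, or all but one, of the earlier vertices shows that at most `Δ + 2` vertices are
present, and these are colored afresh (`totalColorable_of_card_le`).

For the fresh coloring, a vertex adjacent to all others leaves room for one color more than the
order, and the cyclic coloring works. Otherwise the order itself suffices (`totalColorable_card`).
The hard case is even order: color the edges by a one-factorization of the complete graph, and give
each vertex the color of a missing edge at it. Choosing these missing edges along a star forest of
the complement, suitably ordered, keeps the vertex colors proper. -/

/-- A total coloring of `G` with the colors `0, …, k - 1`, given by a map on the vertices and a
symmetric map on the pairs of vertices, of which only the values on adjacent pairs matter. -/
structure IsTotalColoring {V : Type*} (G : SimpleGraph V) (k : ℕ) (f : V → ℕ) (c : V → V → ℕ) :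
    Prop where
  vertex_lt : ∀ u, f u < k
  edge_lt : ∀ u v, c u v < k
  symm : ∀ u v, c u v = c v u
  vertex_vertex : ∀ u v, G.Adj u v → f u ≠ f v
  vertex_edge : ∀ u v, G.Adj u v → f u ≠ c u v
  edge_edge : ∀ u v w, G.Adj u v → G.Adj u w → v ≠ w → c u v ≠ c u w

/-- `G` has a total coloring with `k` colors. -/
def TotalColorable {V : Type*} (G : SimpleGraph V) (k : ℕ) : Prop :=
  ∃ f c, G.IsTotalColoring k f c

variable {V : Type*} {G : SimpleGraph V}

/-! ### Passing between forms of total colorability. -/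

theorem IsTotalColoring.mono {k l : ℕ} {f : V → ℕ} {c : V → V → ℕ} (h : G.IsTotalColoring k f c)
    (hkl : k ≤ l) : G.IsTotalColoring l f c :=
  ⟨fun u => (h.vertex_lt u).trans_le hkl, fun u v => (h.edge_lt u v).trans_le hkl, h.symm,
    h.vertex_vertex, h.vertex_edge, h.edge_edge⟩

theorem TotalColorable.mono {k l : ℕ} (h : G.TotalColorable k) (hkl : k ≤ l) :
    G.TotalColorable l := by
  obtain ⟨f, c, h⟩ := h
  exact ⟨f, c, h.mono hkl⟩

theorem TotalColorable.totalChromaticNumber_le {k : ℕ} (h : G.TotalColorable k) :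
    G.totalChromaticNumber ≤ (k : ℕ∞) := by
  obtain ⟨f, c, h⟩ := h
  refine iInf₂_le k ⟨⟨Sum.elim (fun v => ⟨f v, h.vertex_lt v⟩) (fun e =>
    Sym2.lift ⟨fun u v => (⟨c u v, h.edge_lt u v⟩ : Fin k),
      fun u v => Fin.ext (h.symm u v)⟩ e.1), ?_, ?_, ?_⟩⟩
  · intro u v huv
    simpa [Fin.ext_iff] using h.vertex_vertex u v huv
  · rintro ⟨e, he⟩ ⟨e', he'⟩ hne ⟨v, hv, hv'⟩
    obtain ⟨a, rfl⟩ := hv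
    obtain ⟨b, rfl⟩ := hv'
    have hab : a ≠ b := by
      rintro rfl
      exact hne rfl
    simpa [Fin.ext_iff] using h.edge_edge v a b he he' hab
  · rintro v ⟨e, he⟩ hv
    obtain ⟨a, rfl⟩ := hv
    simpa [Fin.ext_iff] using h.vertex_edge v a he

/-- A graph all of whose edges lie in `S` is totally colorable as soon as `G[S]` is. -/
theorem TotalColorable.of_induce {k : ℕ} {S : Set V} (hk : 0 < k)
    (hS : ∀ u v, G.Adj u v → u ∈ S) (h : (G.induce S).TotalColorable k) :
    G.TotalColorable k := by
  classical
  obtain ⟨f, c, h⟩ := h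
  -- No edge leaves `S`, so the value `0` used elsewhere is never tested; it only has to be a color.
  refine ⟨fun u => if hu : u ∈ S then f ⟨u, hu⟩ else 0,
    fun u v => if huv : u ∈ S ∧ v ∈ S then c ⟨u, huv.1⟩ ⟨v, huv.2⟩ else 0, ?_, ?_, ?_, ?_, ?_, ?_⟩
  · intro u
    split_ifs
    exacts [h.vertex_lt _, hk]
  · intro u v
    split_ifs
    exacts [h.edge_lt _ _, hk]
  · intro u v
    by_cases hu : u ∈ S <;> by_cases hv : v ∈ S <;> simp [hu, hv, h.symm ⟨u, _⟩]
  · intro u v huv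
    have hu := hS u v huv
    have hv := hS v u huv.symm
    simpa [hu, hv] using h.vertex_vertex ⟨u, hu⟩ ⟨v, hv⟩ huv
  · intro u v huv
    have hu := hS u v huv
    have hv := hS v u huv.symm
    simpa [hu, hv] using h.vertex_edge ⟨u, hu⟩ ⟨v, hv⟩ huv
  · intro u v w huv huw hvw
    have hu := hS u v huv
    have hv := hS v u huv.symm
    have hw := hS w u huw.symm
    simpa [hu, hv, hw] using h.edge_edge ⟨u, hu⟩ ⟨v, hv⟩ ⟨w, hw⟩ huv huw (by simpa using hvw)

/-! ### Cyclic colorings modulo an odd number. -/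

theorem eq_of_add_mod_eq {N a b c : ℕ} (hb : b < N) (hc : c < N)
    (h : (a + b) % N = (a + c) % N) : b = c :=
  Nat.ModEq.eq_of_lt_of_lt (Nat.ModEq.add_left_cancel' a h) hb hc

theorem eq_of_two_mul_mod_eq {N b c : ℕ} (hN : Odd N) (hb : b < N) (hc : c < N)
    (h : 2 * b % N = 2 * c % N) : b = c :=
  Nat.ModEq.eq_of_lt_of_lt
    (Nat.ModEq.cancel_left_of_coprime (by simpa using hN) h) hb hc

/-- The cyclic total coloring of a complete graph of odd order. -/
theorem totalColorable_of_odd [Fintype V] {N : ℕ} (hN : Odd N) (hV : Fintype.card V ≤ N) :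
    G.TotalColorable N := by
  classical
  let e := Fintype.equivFin V
  have hlt : ∀ u, (e u : ℕ) < N := fun u => (e u).2.trans_le hV
  have hinj : ∀ u v, (e u : ℕ) = e v → u = v := fun u v h => e.injective (Fin.ext h)
  -- A vertex is colored like a loop, by `i + i`; since `N` is odd, doubling is injective modulo
  -- `N`.
  refine ⟨fun u => 2 * e u % N, fun u v => (e u + e v) % N, fun u => Nat.mod_lt _ hN.pos,
    fun u v => Nat.mod_lt _ hN.pos, fun u v => by rw [add_comm], ?_, ?_, ?_⟩
  · intro u v huv h
    exact huv.ne (hinj _ _ (eq_of_two_mul_mod_eq hN (hlt u) (hlt v) h))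
  · intro u v huv h
    rw [two_mul] at h
    exact huv.ne (hinj _ _ (eq_of_add_mod_eq (hlt u) (hlt v) h))
  · intro u v w _ _ hvw h
    exact hvw (hinj _ _ (eq_of_add_mod_eq (hlt v) (hlt w) h))

theorem totalColorable_card_add_one [Fintype V] :
    G.TotalColorable (Fintype.card V + 1) := by
  rcases Nat.even_or_odd (Fintype.card V) with h | h
  · exact totalColorable_of_odd h.add_one (by omega)
  · exact (totalColorable_of_odd h le_rfl).mono (by omega)

/-! ### Star forests and their orderings. -/

/-- A graph without isolated vertices has a spanning star forest without trivial stars: `g` maps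
each vertex to the center of its star. -/
theorem exists_star_forest [Finite V] (H : SimpleGraph V) (hH : ∀ x, ∃ y, H.Adj x y) :
    ∃ g : V → V, (∀ x, g (g x) = g x) ∧ (∀ x, g x ≠ x → H.Adj x (g x)) ∧
      ∀ x, g x = x → ∃ y, y ≠ x ∧ g y = x := by
  classical
  have := Fintype.ofFinite V
  -- Descent on the number of trivial stars, starting with every vertex alone.
  let lonely (g : V → V) : Finset V := {x | g x = x ∧ ∀ y, g y = x → y = x}
  suffices key : ∀ n, ∀ g : V → V, (∀ x, g (g x) = g x) → (∀ x, g x ≠ x → H.Adj x (g x)) →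
      (lonely g).card = n → ∃ g : V → V, (∀ x, g (g x) = g x) ∧ (∀ x, g x ≠ x → H.Adj x (g x)) ∧
      ∀ x, g x = x → ∃ y, y ≠ x ∧ g y = x from
    key _ id (fun _ => rfl) (fun x hx => (hx rfl).elim) rfl
  intro n
  induction n using Nat.strong_induction_on with
  | _ n ih =>
  intro g hg hadj hn
  by_cases hlon : ∃ x, x ∈ lonely g
  swap
  · refine ⟨g, hg, hadj, fun x hx => ?_⟩
    by_contra hcon
    push Not at hcon
    refine hlon ⟨x, ?_⟩
    simp only [lonely, Finset.mem_filter, Finset.mem_univ, true_and]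
    exact ⟨hx, fun y hy => by_contra fun h => hcon y h hy⟩
  obtain ⟨x, hx⟩ := hlon
  have step : ∀ g' : V → V, (∀ x, g' (g' x) = g' x) → (∀ x, g' x ≠ x → H.Adj x (g' x)) →
      (∀ z, g' z = z → (∀ y, g' y = z → y = z) → z ≠ x ∧ z ∈ lonely g) →
      ∃ g : V → V, (∀ x, g (g x) = g x) ∧ (∀ x, g x ≠ x → H.Adj x (g x)) ∧
      ∀ x, g x = x → ∃ y, y ≠ x ∧ g y = x := by
    intro g' h1 h2 h3
    refine ih _ ?_ g' h1 h2 rfl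
    rw [← hn]
    refine Finset.card_lt_card (Finset.ssubset_iff_subset_ne.2 ⟨fun z hz => ?_, fun heq => ?_⟩)
    · simp only [lonely, Finset.mem_filter, Finset.mem_univ, true_and] at hz
      exact (h3 z hz.1 hz.2).2
    · rw [← heq] at hx
      simp only [lonely, Finset.mem_filter, Finset.mem_univ, true_and] at hx
      exact (h3 x hx.1 hx.2).1 rfl
  simp only [lonely, Finset.mem_filter, Finset.mem_univ, true_and] at hx step
  obtain ⟨hgx, hxl⟩ := hx
  obtain ⟨y, hxy⟩ := hH x
  have hne := hxy.ne
  have hyx := hxy.symm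
  -- If `y` is a center, `x` joins it. If `y` shares its star with another leaf, it leaves to form a
  -- star with `x`. Otherwise its star is a single edge, which is recentered at `y` before `x`
  -- joins.
  by_cases hy : g y = y
  · refine step (fun z => if z = x then y else g z) ?_ ?_ ?_
    · grind
    · grind
    · grind
  by_cases hz : ∃ z, z ≠ y ∧ z ≠ g y ∧ g z = g y
  · obtain ⟨z, hzy, hzg, hz⟩ := hz
    refine step (fun z => if z = x ∨ z = y then y else g z) ?_ ?_ ?_
    · grind
    · grind
    · grind
  · have hsy := (hadj y hy).symm
    refine step (fun z => if z = x ∨ z = y ∨ z = g y then y else g z) ?_ ?_ ?_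
    · grind
    · grind
    · grind

/-- An ordering of the vertices of a star forest, the centers first, then the leaves in the order
of their centers. -/
theorem exists_equiv_fin_star_forest [Fintype V] (g : V → V) (hg : ∀ x, g (g x) = g x) :
    ∃ e : V ≃ Fin (Fintype.card V), (∀ x y, g x = x → g y ≠ y → e x < e y) ∧
      ∀ x y, g x ≠ x → g y ≠ y → e x < e y → e (g x) ≤ e (g y) := by
  classical
  let i := Fintype.equivFin V
  let key : V → Bool ×ₗ (Fin (Fintype.card V) ×ₗ Fin (Fintype.card V)) := fun x =>
    toLex (decide (g x ≠ x), toLex (i (g x), i x))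
  have hkey : Function.Injective key := by
    intro x y h
    simp only [key, EmbeddingLike.apply_eq_iff_eq, Prod.mk.injEq] at h
    exact h.2.2
  let _ : LinearOrder V := LinearOrder.lift' key hkey
  have hlt : ∀ x y : V, x < y ↔ key x < key y := fun _ _ => Iff.rfl
  have hle : ∀ x y : V, x ≤ y ↔ key x ≤ key y := fun _ _ => Iff.rfl
  let e := (Fintype.orderIsoFinOfCardEq V rfl).symm
  refine ⟨e.toEquiv, fun x y hx hy => ?_, fun x y hx hy hxy => ?_⟩
  · show e x < e y
    rw [e.lt_iff_lt, hlt]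
    simp [key, Prod.Lex.toLex_lt_toLex, hx, hy]
  · replace hxy : e x < e y := hxy
    show e (g x) ≤ e (g y)
    rw [e.lt_iff_lt, hlt] at hxy
    rw [e.le_iff_le, hle]
    simp [key, Prod.Lex.toLex_lt_toLex, Prod.Lex.toLex_le_toLex, hx, hy, hg] at hxy ⊢
    rcases hxy with h | h
    · exact Or.inl h
    · exact Or.inr ⟨h.1, (congrArg i h.1).le⟩

/-! ### Even order without a universal vertex. -/

/-- A graph of even order `n` without a vertex adjacent to all others has a total coloring with
`n` colors. -/
theorem totalColorable_card_of_even [Fintype V] (heven : Even (Fintype.card V))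
    (hG : ∀ x, ∃ y, Gᶜ.Adj x y) : G.TotalColorable (Fintype.card V) := by
  classical
  rcases isEmpty_or_nonempty V with hV | hV
  · exact ⟨isEmptyElim, isEmptyElim, isEmptyElim, isEmptyElim, isEmptyElim, isEmptyElim,
      isEmptyElim, isEmptyElim⟩
  obtain ⟨g, hg, hgadj, hcenter⟩ := exists_star_forest Gᶜ hG
  obtain ⟨e, hcl, hmono⟩ := exists_equiv_fin_star_forest g hg
  obtain ⟨N, hN⟩ : ∃ N, Fintype.card V = N + 1 :=
    Nat.exists_eq_succ_of_ne_zero Fintype.card_pos.ne'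
  have hNodd : Odd N := by
    rw [hN] at heven
    exact Nat.even_add_one.1 heven |> Nat.not_even_iff_odd.1
  have hNpos := hNodd.pos
  obtain ⟨a, ha⟩ : ∃ a : V → ℕ, a = fun x => (e x : ℕ) := ⟨_, rfl⟩
  have hinj : ∀ x y, a x = a y → x = y := by
    subst ha
    exact fun x y h => e.injective (Fin.ext h)
  have hle : ∀ x, a x ≤ N := by
    subst ha
    exact fun x => Nat.lt_succ_iff.1 ((e x).2.trans_eq hN)
  replace hcl : ∀ x y, g x = x → g y ≠ y → a x < a y := by
    subst ha
    exact hcl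
  replace hmono : ∀ x y, g x ≠ x → g y ≠ y → a x < a y → a (g x) ≤ a (g y) := by
    subst ha
    exact hmono
  clear ha
  have hlast : ∀ x, a x = N → g x ≠ x := by
    intro x hx hgx
    obtain ⟨y, hyx, hgy⟩ := hcenter x hgx
    have := hcl x y hgx (by rw [hgy]; exact hyx.symm)
    have := hle y
    omega
  -- The sums increase strictly along the leaves, and as centers precede leaves, two of them differ
  -- by less than `N`.
  have hsum_aux : ∀ x y, g x ≠ x → g y ≠ y → a x < a y → a y ≠ N →
      (a x + a (g x)) % N ≠ (a y + a (g y)) % N := by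
    intro x y hx hy hxy hyN h
    have h1 := hcl (g y) x (hg y) hx
    have h2 := hmono x y hx hy hxy
    have h3 := hle y
    have h4 := (Nat.modEq_iff_dvd' (by omega : a x + a (g x) ≤ a y + a (g y))).1 h
    have h5 := Nat.le_of_dvd (by omega) h4
    omega
  have hsum : ∀ x y, g x ≠ x → g y ≠ y → a x ≠ N → a y ≠ N →
      (a x + a (g x)) % N = (a y + a (g y)) % N → x = y := by
    intro x y hx hy hxN hyN h
    rcases lt_trichotomy (a x) (a y) with hxy | hxy | hxy
    · exact (hsum_aux x y hx hy hxy hyN h).elim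
    · exact hinj x y hxy
    · exact (hsum_aux y x hy hx hxy hxN h.symm).elim
  -- A leaf is paired with its center, a center with one chosen leaf; the missing edges used are
  -- thus indexed by leaves.
  have hpartner : ∀ x, ∃ y, y ≠ x ∧ (g x ≠ x ∧ y = g x ∨ g x = x ∧ g y = x) := by
    intro x
    by_cases hx : g x = x
    · obtain ⟨y, hy, hgy⟩ := hcenter x hx
      exact ⟨y, hy, Or.inr ⟨hx, hgy⟩⟩
    · exact ⟨g x, hx, Or.inl ⟨hx, rfl⟩⟩
  choose p hpne hp using hpartner
  have hpadj : ∀ x, ¬ G.Adj x (p x) := by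
    intro x
    rcases hp x with ⟨hx, h⟩ | ⟨hx, h⟩
    · rw [h]
      exact ((compl_adj _ _ _).1 (hgadj x hx)).2
    · have := hgadj (p x) (by rw [h]; exact (hpne x).symm)
      rw [h] at this
      exact fun h' => ((compl_adj _ _ _).1 this).2 h'.symm
  have hcollide : ∀ x y, a x ≠ N → a (p x) ≠ N → a y ≠ N → a (p y) ≠ N →
      (a x + a (p x)) % N = (a y + a (p y)) % N → x = y ∨ y = p x := by
    intro x y hx hpx hy hpy h
    have := hpne x
    have := hpne y
    rcases hp x with ⟨hx1, hx2⟩ | ⟨hx1, hx2⟩ <;> rcases hp y with ⟨hy1, hy2⟩ | ⟨hy1, hy2⟩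
    · have := hsum x y hx1 hy1 hx hy (by rwa [← hx2, ← hy2])
      exact Or.inl this
    · have := hsum x (p y) hx1 (by grind) hx hpy (by rw [hy2, ← hx2, h, add_comm])
      grind
    · have := hsum (p x) y (by grind) hy1 hpx hy (by rw [hx2, ← hy2, ← h, add_comm])
      grind
    · have := hsum (p x) (p y) (by grind) (by grind) hpx hpy
        (by rw [hx2, hy2, add_comm, h, add_comm])
      grind
  have hlt : ∀ x, a x ≠ N → a x < N := fun x hx => lt_of_le_of_ne (hle x) hx
  -- Sums modulo `N` leave the color `2 * a y` free at `y`; the edge from `y` to the last vertex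
  -- takes it.
  obtain ⟨c, hc⟩ : ∃ c : V → V → ℕ, c = fun x y =>
      if a x = N then 2 * a y % N else if a y = N then 2 * a x % N else (a x + a y) % N := ⟨_, rfl⟩
  -- The color `N`, used by no edge, serves when the missing edge meets the last vertex.
  obtain ⟨f, hf⟩ : ∃ f : V → ℕ, f = fun x =>
      if a x = N ∨ a (p x) = N then N else (a x + a (p x)) % N := ⟨_, rfl⟩
  have hclt : ∀ x y, c x y < N := by
    intro x y
    rw [hc]
    dsimp only
    split_ifs <;> exact Nat.mod_lt _ hNpos
  have hmod : ∀ k, k % N ≠ N := fun k => (Nat.mod_lt k hNpos).ne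
  rw [hN]
  refine ⟨f, c, fun x => ?_, fun x y => (hclt x y).trans (Nat.lt_succ_self N), fun x y => ?_,
    fun x y hxy h => ?_, fun x y hxy h => ?_, fun x y z hxy hxz hyz h => hyz ?_⟩
  · rw [hf]
    dsimp only
    split_ifs
    · exact Nat.lt_succ_self N
    · exact (Nat.mod_lt _ hNpos).trans (Nat.lt_succ_self N)
  · simp only [hc]
    split_ifs with h1 h2
    · rw [h1, h2]
    · rfl
    · rfl
    · rw [add_comm]
  · have hne := hxy.ne
    have h1 := hpadj x
    have h2 := hpadj y
    have h3 := hxy.symm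
    simp only [hf] at h
    by_cases hx : a x = N ∨ a (p x) = N <;> by_cases hy : a y = N ∨ a (p y) = N
    -- Only the last vertex and the center of its star can have color `N`, and they are not
    -- adjacent.
    · have hpeq : ∀ z, a (p z) = N → g (p z) = z := by
        intro z hz
        rcases hp z with ⟨-, h⟩ | ⟨-, h⟩
        · exact (hlast _ hz (by rw [h, hg])).elim
        · exact h
      rcases hx with hx | hx <;> rcases hy with hy | hy
      · exact hne (hinj _ _ (hx.trans hy.symm))
      · rw [hinj _ _ (hx.trans hy.symm)] at h3
        exact h2 h3
      · rw [hinj _ _ (hy.trans hx.symm)] at hxy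
        exact h1 hxy
      · have := hinj _ _ (hx.trans hy.symm)
        exact hne (by rw [← hpeq x hx, ← hpeq y hy, this])
    · rw [if_pos hx, if_neg hy] at h
      exact hmod _ h.symm
    · rw [if_neg hx, if_pos hy] at h
      exact hmod _ h
    · rw [if_neg hx, if_neg hy] at h
      push Not at hx hy
      rcases hcollide x y hx.1 hx.2 hy.1 hy.2 h with h | h
      · exact hne h
      · exact h1 (h ▸ hxy)
  · by_cases hx : a x = N ∨ a (p x) = N
    · have := hclt x y
      rw [← h, hf] at this
      simp [hx] at this
    · simp only [hf, if_neg hx] at h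
      push Not at hx
      simp only [hc, if_neg hx.1] at h
      split_ifs at h with hy
      · rw [two_mul] at h
        exact hpne x (hinj _ _ (eq_of_add_mod_eq (hlt _ hx.2) (hlt _ hx.1) h))
      · have := hinj _ _ (eq_of_add_mod_eq (hlt _ hx.2) (hlt _ hy) h)
        exact hpadj x (this ▸ hxy)
  · simp only [hc] at h
    split_ifs at h with hx hy hz hz
    · have hy : a y ≠ N := fun hy => hxy.ne (hinj _ _ (hx.trans hy.symm))
      have hz : a z ≠ N := fun hz => hxz.ne (hinj _ _ (hx.trans hz.symm))
      exact hinj _ _ (eq_of_two_mul_mod_eq hNodd (hlt _ hy) (hlt _ hz) h)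
    · exact hinj _ _ (hy.trans hz.symm)
    · rw [two_mul] at h
      exact (hxz.ne (hinj _ _ (eq_of_add_mod_eq (hlt _ hx) (hlt _ hz) h))).elim
    · rw [two_mul] at h
      exact (hxy.ne (hinj _ _ (eq_of_add_mod_eq (hlt _ hy) (hlt _ hx) h)).symm).elim
    · exact hinj _ _ (eq_of_add_mod_eq (hlt _ ‹_›) (hlt _ hz) h)

/-- If all vertices have degree at most `|V| - 2` then `|V|` colors suffice. -/
theorem totalColorable_card [Fintype V] (hG : ∀ x, ∃ y, Gᶜ.Adj x y) :
    G.TotalColorable (Fintype.card V) := by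
  rcases Nat.even_or_odd (Fintype.card V) with h | h
  · exact totalColorable_card_of_even h hG
  · exact totalColorable_of_odd h le_rfl

/-! ### Adding vertices in the mock threshold order. -/

/-- A total coloring extends to a graph with one more edge `uv`, where `v` was isolated. -/
theorem TotalColorable.extend_pendant [Fintype V] {H : SimpleGraph V} [DecidableRel H.Adj]
    {k : ℕ} {u v : V} (hH : H.TotalColorable k) (huv : u ≠ v) (hv : ∀ x, ¬ H.Adj v x)
    (hk : H.degree u + 1 < k) (hk3 : 2 < k)
    (hG : ∀ x y, G.Adj x y → H.Adj x y ∨ x = u ∧ y = v ∨ x = v ∧ y = u) :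
    G.TotalColorable k := by
  classical
  obtain ⟨f, c, h⟩ := hH
  obtain ⟨b, hbk, hb⟩ : ∃ b ∈ Finset.range k,
      b ∉ insert (f u) ((H.neighborFinset u).image (c u)) := by
    refine Finset.exists_mem_notMem_of_card_lt_card ?_
    rw [Finset.card_range]
    refine (Finset.card_insert_le _ _).trans_lt (lt_of_le_of_lt ?_ hk)
    exact Nat.succ_le_succ (Finset.card_image_le.trans (H.card_neighborFinset_eq_degree u).le)
  -- As `v` was isolated, its old color can be dropped; the new one avoids only `u` and the edge
  -- `uv`.
  obtain ⟨d, hdk, hd⟩ : ∃ d ∈ Finset.range k, d ∉ ({f u, b} : Finset ℕ) := by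
    refine Finset.exists_mem_notMem_of_card_lt_card ?_
    rw [Finset.card_range]
    exact Finset.card_le_two.trans_lt hk3
  simp only [Finset.mem_range] at hbk hdk
  simp only [Finset.mem_insert, Finset.mem_image, mem_neighborFinset, not_or, not_exists, not_and,
    Finset.mem_singleton] at hb hd
  obtain ⟨hbu, hb⟩ := hb
  obtain ⟨hdu, hdb⟩ := hd
  have hv' : ∀ x, ¬ H.Adj x v := fun x hx => hv x hx.symm
  have h1 := h.vertex_vertex
  have h2 := h.vertex_edge
  have h3 := h.edge_edge
  refine ⟨fun x => if x = v then d else f x, fun x y => if x = v ∨ y = v then b else c x y,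
    fun x => ?_, fun x y => ?_, fun x y => ?_, fun x y hxy => ?_, fun x y hxy => ?_,
    fun x y z hxy hxz hyz => ?_⟩
  · split_ifs
    exacts [hdk, h.vertex_lt x]
  · split_ifs
    exacts [hbk, h.edge_lt x y]
  · simp only [or_comm (a := x = v), h.symm x y]
  · have := hG x y hxy
    grind
  · have := hG x y hxy
    grind
  · have := hG x y hxy
    have := hG x z hxz
    grind

theorem initialDegree_eq_card [Fintype V] [DecidableRel G.Adj] {n : ℕ} (σ : Fin n ≃ V)
    (i : Fin n) :
    G.initialDegree σ i = (Finset.univ.filter fun x => G.Adj (σ i) x ∧ σ.symm x < i).card := by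
  classical
  unfold initialDegree
  rw [← card_neighborFinset_eq_degree, ← Finset.card_map (Function.Embedding.subtype _)]
  congr 1
  ext x
  simp only [Finset.mem_map, mem_neighborFinset, comap_adj, Function.Embedding.subtype_apply,
    Subtype.exists, Finset.mem_filter, Finset.mem_univ, true_and]
  constructor
  · rintro ⟨y, ⟨j, hj, rfl⟩, hadj, rfl⟩
    refine ⟨hadj, ?_⟩
    rw [σ.symm_apply_apply]
    refine lt_of_le_of_ne hj ?_
    rintro rfl
    exact hadj.ne rfl
  · rintro ⟨hadj, hlt⟩
    exact ⟨x, ⟨_, hlt.le, σ.apply_symm_apply x⟩, hadj, rfl⟩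

/-- The spanning subgraph of `G` formed by the edges among the first `k` vertices of `σ`. -/
def initialSubgraph (G : SimpleGraph V) {n : ℕ} (σ : Fin n ≃ V) (k : ℕ) : SimpleGraph V where
  Adj x y := G.Adj x y ∧ (σ.symm x : ℕ) < k ∧ (σ.symm y : ℕ) < k
  symm := ⟨fun _ _ h => ⟨h.1.symm, h.2.2, h.2.1⟩⟩
  loopless := ⟨fun _ h => h.1.ne rfl⟩


/-- `Δ + 2` colors suffice for a subgraph on at most `Δ + 2` vertices. -/
theorem totalColorable_of_card_le [Fintype V] [DecidableRel G.Adj] {H : SimpleGraph V}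
    (hHG : H ≤ G) (S : Finset V) (hS : ∀ x y, H.Adj x y → x ∈ S)
    (hcard : S.card ≤ G.maxDegree + 2) : H.TotalColorable (G.maxDegree + 2) := by
  classical
  refine TotalColorable.of_induce (S := (S : Set V)) (by omega) hS ?_
  have hcard' : Fintype.card (S : Set V) = S.card := by simp
  by_cases hx : ∀ x, ∃ y, (H.induce (S : Set V))ᶜ.Adj x y
  · exact (totalColorable_card hx).mono (by omega)
  -- A vertex adjacent to the rest of `S` forces `S.card ≤ G.maxDegree + 1`, so one extra color is
  -- available.
  · push Not at hx
    obtain ⟨⟨x, hxS⟩, hx⟩ := hx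
    have hsub : S.erase x ⊆ G.neighborFinset x := by
      intro y hy
      rw [Finset.mem_erase] at hy
      have := hx ⟨y, hy.2⟩
      rw [mem_neighborFinset]
      apply hHG
      by_contra hadj
      exact this ((compl_adj _ _ _).2 ⟨fun h => hy.1 (congrArg Subtype.val h).symm, hadj⟩)
    have h1 := Finset.card_le_card hsub
    rw [Finset.card_erase_of_mem hxS, card_neighborFinset_eq_degree] at h1
    have h2 := G.degree_le_maxDegree x
    exact totalColorable_card_add_one.mono (by omega)

theorem IsMockThreshold.totalColorable [Fintype V] [DecidableRel G.Adj]
    (hG : G.IsMockThreshold) : G.TotalColorable (G.maxDegree + 2) := by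
  classical
  obtain ⟨σ, hσ⟩ := hG
  -- Later vertices stay present but isolated, and the bound uses the maximum degree of the final
  -- graph throughout.
  suffices key : ∀ k ≤ Fintype.card V,
      (G.initialSubgraph σ k).TotalColorable (G.maxDegree + 2) by
    have hfull : G.initialSubgraph σ (Fintype.card V) = G := by
      ext x y
      simp [initialSubgraph]
    have hcol := key _ le_rfl
    rwa [hfull] at hcol
  intro k
  induction k with
  | zero =>
    exact fun _ => totalColorable_of_card_le (fun x y h => h.1) ∅
      (fun x y h => (Nat.not_lt_zero _ h.2.1).elim) (by simp)
  | succ k ih =>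
    intro hk
    replace ih := ih (by omega)
    have hdeg := hσ ⟨k, hk⟩
    rw [initialDegree_eq_card] at hdeg
    obtain ⟨v, hv⟩ : ∃ v, v = σ ⟨k, hk⟩ := ⟨_, rfl⟩
    obtain ⟨B, hB⟩ : ∃ B : Finset V,
        B = Finset.univ.filter fun x => G.Adj v x ∧ σ.symm x < ⟨k, hk⟩ := ⟨_, rfl⟩
    rw [← hv, ← hB] at hdeg
    replace hB : ∀ x, x ∈ B ↔ G.Adj v x ∧ (σ.symm x : ℕ) < k := by
      intro x
      rw [hB, Finset.mem_filter, Fin.lt_def]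
      simp
    have hvk : (σ.symm v : ℕ) = k := by rw [hv, σ.symm_apply_apply]
    have hkv : ∀ x, (σ.symm x : ℕ) = k → x = v := fun x hx =>
      σ.symm.injective (Fin.ext (hx.trans hvk.symm))
    have hadj : ∀ x y, (G.initialSubgraph σ (k + 1)).Adj x y →
        (G.initialSubgraph σ k).Adj x y ∨ x ∈ B ∧ y = v ∨ x = v ∧ y ∈ B := by
      rintro x y ⟨hxy, hx, hy⟩
      simp only [hB]
      rcases Nat.lt_succ_iff_lt_or_eq.1 hx with hx | hx <;>
        rcases Nat.lt_succ_iff_lt_or_eq.1 hy with hy | hy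
      · exact Or.inl ⟨hxy, hx, hy⟩
      · rw [hkv y hy] at hxy ⊢
        exact Or.inr (Or.inl ⟨⟨hxy.symm, hx⟩, rfl⟩)
      · rw [hkv x hx] at hxy ⊢
        exact Or.inr (Or.inr ⟨rfl, hxy, hy⟩)
      · exact (hxy.ne ((hkv x hx).trans (hkv y hy).symm)).elim
    have hBmax : B.card ≤ G.maxDegree := by
      refine le_trans (Finset.card_le_card fun x hx => ?_) (G.degree_le_maxDegree v)
      exact (G.mem_neighborFinset v x).2 ((hB x).1 hx).1
    -- Since `B.card ≤ G.maxDegree`, the `k + 1` vertices present number at most `G.maxDegree + 2`.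
    have hlarge : k ≤ B.card + 1 →
        (G.initialSubgraph σ (k + 1)).TotalColorable (G.maxDegree + 2) := by
      intro hkB
      refine totalColorable_of_card_le (fun x y h => h.1)
        (Finset.univ.filter fun x => (σ.symm x : ℕ) < k + 1)
        (fun x y h => by simpa using h.2.1) ?_
      have : (Finset.univ.filter fun x => (σ.symm x : ℕ) < k + 1).card ≤
          (Finset.range (k + 1)).card :=
        Finset.card_le_card_of_injOn (fun x => (σ.symm x : ℕ)) (fun x hx => by simpa using hx)
          (fun x _ y _ h => σ.symm.injective (Fin.ext h))
      rw [Finset.card_range] at this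
      omega
    rcases hdeg with h | h | h | h
    · rw [Finset.card_eq_zero] at h
      subst h
      obtain ⟨f, c, hfc⟩ := ih
      have hadj' : ∀ x y, (G.initialSubgraph σ (k + 1)).Adj x y →
          (G.initialSubgraph σ k).Adj x y := fun x y h => by simpa using hadj x y h
      exact ⟨f, c, hfc.vertex_lt, hfc.edge_lt, hfc.symm,
        fun x y h => hfc.vertex_vertex x y (hadj' x y h),
        fun x y h => hfc.vertex_edge x y (hadj' x y h),
        fun x y z h h' => hfc.edge_edge x y z (hadj' x y h) (hadj' x z h')⟩
    · obtain ⟨u, rfl⟩ := Finset.card_eq_one.1 h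
      have hu := (hB u).1 (Finset.mem_singleton_self u)
      have hvH : ∀ x, ¬ (G.initialSubgraph σ k).Adj v x := fun x hx => by
        have := hx.2.1
        omega
      refine ih.extend_pendant (u := u) (v := v) hu.1.ne' hvH ?_ (by omega) fun x y hxy => by
        simpa using hadj x y hxy
      have hlt : (G.initialSubgraph σ k).degree u < G.degree u := by
        refine Finset.card_lt_card (Finset.ssubset_iff_of_subset (fun x hx => ?_) |>.2
          ⟨v, (G.mem_neighborFinset u v).2 hu.1.symm, fun h => ?_⟩)
        · exact (G.mem_neighborFinset u x).2 ((mem_neighborFinset _ _ _).1 hx).1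
        · exact hvH u ((mem_neighborFinset _ _ _).1 h).symm
      have := G.degree_le_maxDegree u
      omega
    · exact hlarge h.ge
    · refine hlarge ?_
      change B.card = k at h
      omega

end SimpleGraph

theorem mainTheorem6 {V : Type*} [Fintype V] (G : SimpleGraph V) [DecidableRel G.Adj]
    (hG : G.IsMockThreshold) :
    G.totalChromaticNumber ≤ (G.maxDegree : ℕ∞) + 2 := by
  exact_mod_cast hG.totalColorable.totalChromaticNumber_le
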